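/- Let $n\ge 1$, let $\mathcal P_n$ be the cone of real symmetric positive-definite $n\times n$ matrices, and for $\beta<1/n$ let $\mathcal M_n^\beta$ denote $\mathcal P_n$ with the Riemannian metric $$g_X^\beta(S,T)=(\det X)^\beta\bigl(\operatorname{tr}(X^{-1}SX^{-1}T)-\beta\operatorname{tr}(X^{-1}S)\operatorname{tr}(X^{-1}T)\bigr)$$ ($X\in\mathcal P_n$, $S,T$ symmetric). For $A,B\in\mathcal P_n$ let $$d_\beta(A,B)=\inf_P\int_0^1\sqrt{g^\beta_{P(t)}(P'(t),P'(t))}\,dt$$ be the Riemannian distance of $\mathcal M_n^\beta$, the infimum being over the $C^2$ curves $P:[0,1]\to\mathcal P_n$ with $P(0)=A$, $P(1)=B$. Let $\delta(A,B)=\bigl(\sum_{i=1}^n\ln^2\lambda_i\bigr)^{1/2}$, where $\lambda_1,\dots,\lambda_n$ are the eigenvalues of $A^{-1}B$ with multiplicity, and put $$\gamma_\beta(A,B)=\frac{|\beta|\,\delta\bigl(\det(A)^{-1/n}A,\ \det(B)^{-1/n}B\bigr)}{2\sqrt{1/n-\beta}}.$$ **Theorem.** Let $A,B\in\mathcal P_n$.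 1. For every $\beta\in(-\infty,0)\cup(0,1/n)$ such that $\gamma:=\gamma_\beta(A,B)$ satisfies $0<\gamma<\pi/2$, $$d_\beta(A,B)=\frac{2\sqrt{1/n-\beta}}{|\beta|}\Bigl(\bigl(\det(A)^{\beta/2}-\det(B)^{\beta/2}\bigr)^2+4(\det(A)\det(B))^{\beta/2}\sin^2\frac{\gamma}{2}\Bigr)^{1/2}.$$ 2. $\delta$ is the Riemannian distance of the affine-invariant metric $g_X^0(S,T)=\operatorname{tr}(X^{-1}SX^{-1}T)$, that is, $d_0(A,B)=\delta(A,B)$; and $$\lim_{\beta\to0,\ \beta\neq0}d_\beta(A,B)=\delta(A,B).$$ -/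

import Mathlib

open Filter Topology

noncomputable section

namespace PowerPotential

/-- The bilinear form
`g_X^β(S, T) = (det X)^β (tr(X⁻¹ S X⁻¹ T) - β tr(X⁻¹ S) tr(X⁻¹ T))`
on symmetric matrices `S, T`, at a positive-definite matrix `X`.
For `β ≠ 0`, `β < 1/n`, it is the Hessian at `X` of the power potential
`(1 - (det X)^β) / β`, and a Riemannian metric on the cone of positive-definite matrices.
For `β = 0` it is the affine-invariant metric `tr(X⁻¹ S X⁻¹ T)`. -/
def metric {n : ℕ} (β : ℝ) (X S T : Matrix (Fin n) (Fin n) ℝ) : ℝ :=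
  X.det ^ β * ((X⁻¹ * S * X⁻¹ * T).trace - β * (X⁻¹ * S).trace * (X⁻¹ * T).trace)

/-- `P`, restricted to `[0, 1]`, is a `C²` curve of positive-definite matrices from `A` to `B`. -/
structure IsCurve {n : ℕ} (A B : Matrix (Fin n) (Fin n) ℝ)
    (P : ℝ → Matrix (Fin n) (Fin n) ℝ) : Prop where
  contDiffOn : ∀ i j, ContDiffOn ℝ 2 (fun t => P t i j) (Set.Icc 0 1)
  posDef : ∀ t ∈ Set.Icc (0 : ℝ) 1, (P t).PosDef
  source : P 0 = A
  target : P 1 = B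

/-- The (entrywise) derivative `P'(t)` of a curve on `[0, 1]`, one-sided at the endpoints. -/
def velocity {n : ℕ} (P : ℝ → Matrix (Fin n) (Fin n) ℝ) (t : ℝ) : Matrix (Fin n) (Fin n) ℝ :=
  Matrix.of fun i j => derivWithin (fun s => P s i j) (Set.Icc 0 1) t

/-- The length `∫₀¹ √(g_{P(t)}^β(P'(t), P'(t))) dt` of a curve. -/
def length {n : ℕ} (β : ℝ) (P : ℝ → Matrix (Fin n) (Fin n) ℝ) : ℝ :=
  ∫ t in (0 : ℝ)..1, Real.sqrt (metric β (P t) (velocity P t) (velocity P t))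

/-- The Riemannian distance `d_β(A, B)`: the infimum of the lengths, in the metric `g^β`,
of the `C²` curves of positive-definite matrices joining `A` to `B`. -/
def riemannianDist {n : ℕ} (β : ℝ) (A B : Matrix (Fin n) (Fin n) ℝ) : ℝ :=
  sInf {L : ℝ | ∃ P : ℝ → Matrix (Fin n) (Fin n) ℝ, IsCurve A B P ∧ L = length β P}

/-- `δ(M, N) = (∑ i, (ln λ_i)²)^{1/2}`, where `λ_1, …, λ_n` are the eigenvalues of `M⁻¹ N`
counted with algebraic multiplicity (all real and positive for positive-definite `M, N`). -/
def affineDist {n : ℕ} (M N : Matrix (Fin n) (Fin n) ℝ) : ℝ :=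
  Real.sqrt (((M⁻¹ * N).charpoly.roots.map fun l => Real.log l ^ 2).sum)

/-- The rescaling `det(A)^{-1/n} A` of `A` to determinant one. -/
def normalize {n : ℕ} (A : Matrix (Fin n) (Fin n) ℝ) : Matrix (Fin n) (Fin n) ℝ :=
  A.det ^ (-(1 / (n : ℝ))) • A

/-- `γ_β(A, B) = |β| δ(det(A)^{-1/n} A, det(B)^{-1/n} B) / (2 √(1/n - β))`. -/
def angle {n : ℕ} (β : ℝ) (A B : Matrix (Fin n) (Fin n) ℝ) : ℝ :=
  |β| * affineDist (normalize A) (normalize B) / (2 * Real.sqrt (1 / (n : ℝ) - β))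

end PowerPotential

end

/-!
Write `X = e^s Y` with `det Y = 1`. In the variables `r = c (det X)^{β/2}`,
`c = 2 √(1/n - β) / |β|`, and `Y`, the metric `g^β` is `dr² + (r/c)² g⁰_Y`: a cone over the
unimodular matrices with the affine-invariant metric. The claimed distance is the law of cosines in
that cone, for points at distances `c (det A)^{β/2}` and `c (det B)^{β/2}` from the apex and at
angle `γ`.

By congruence (`riemannianDist_congr`, `exists_congr_one_diagonal`) one may take `A = 1` and
`B = diag(e^{a_i})`.

For the lower bound, no geodesics and no comparison theory are used. The logarithms of the pivots in
the `LDLᵀ` decomposition (`IsLogPivots`) give coordinates `x X` in `ℝⁿ`, with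
`∑ x_i = log det X`, whose velocity along a curve is bounded by that of the curve
(`trace_inv_mul_schur`): the pivots project positive-definite matrices onto diagonal ones without
increasing lengths. On diagonal matrices `g^β` is
`e^{β ∑ y_i} (|dy|² - β (∑ dy_i)²)`. Keep only the component of `y` along the trace-free part of `a`
and the sum of the `y_i`; these are an angle and the logarithm of a radius, in which the metric is
that of the Euclidean plane in polar coordinates. A linear function of the plane, pulled back to
matrices, is therefore 1-Lipschitz, so that a curve is at least as long as the chord between the
images of its endpoints (`mul_sqrt_sqChord_le_length`).

For the upper bound, the chord does not meet the origin as its angle is less than `π/2`; its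
logarithm is a curve of diagonal matrices whose length is that of the chord
(`exists_isCurve_length_le`). For `β = 0` the diagonal matrices are flat and both bounds use a
straight line. The formula also holds at angle zero, so it is valid for all small `β ≠ 0`, and the
limit follows by continuity.
-/

namespace PowerPotential

open Matrix

noncomputable section

/-! ### Congruence -/

section Congruence

theorem trace_submatrix_self_equiv {ι κ : Type*} [Fintype ι] [Fintype κ] (e : ι ≃ κ)
    (M : Matrix κ κ ℝ) : (M.submatrix e e).trace = M.trace :=
  e.sum_comp fun k => M k k

theorem trace_fromBlocks {ι κ : Type*} [Fintype ι] [Fintype κ] (A : Matrix ι ι ℝ)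
    (B : Matrix ι κ ℝ) (C : Matrix κ ι ℝ) (D : Matrix κ κ ℝ) :
    (fromBlocks A B C D).trace = A.trace + D.trace := by
  simp [Matrix.trace]

variable {ι : Type*} [Fintype ι] [DecidableEq ι]

theorem inv_mul_congr {G : Matrix ι ι ℝ} (hG : IsUnit G.det) (X S : Matrix ι ι ℝ) :
    (G * X * Gᵀ)⁻¹ * (G * S * Gᵀ) = Gᵀ⁻¹ * (X⁻¹ * S) * Gᵀ := by
  simp only [Matrix.mul_inv_rev, Matrix.mul_assoc]
  rw [Matrix.nonsing_inv_mul_cancel_left _ _ hG]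

theorem trace_inv_mul_congr {G : Matrix ι ι ℝ} (hG : IsUnit G.det) (X S : Matrix ι ι ℝ) :
    ((G * X * Gᵀ)⁻¹ * (G * S * Gᵀ)).trace = (X⁻¹ * S).trace := by
  have hG' : IsUnit Gᵀ.det := by rwa [det_transpose]
  rw [inv_mul_congr hG, trace_mul_comm, ← Matrix.mul_assoc, mul_nonsing_inv _ hG', Matrix.one_mul]

theorem trace_inv_mul_inv_mul_congr {G : Matrix ι ι ℝ} (hG : IsUnit G.det)
    (X S T : Matrix ι ι ℝ) :
    ((G * X * Gᵀ)⁻¹ * (G * S * Gᵀ) * (G * X * Gᵀ)⁻¹ * (G * T * Gᵀ)).trace =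
      (X⁻¹ * S * X⁻¹ * T).trace := by
  have hG' : IsUnit Gᵀ.det := by rwa [det_transpose]
  rw [Matrix.mul_assoc _ _ (G * T * Gᵀ), inv_mul_congr hG, inv_mul_congr hG,
    Matrix.mul_assoc, Matrix.mul_assoc, trace_mul_comm]
  simp only [Matrix.mul_assoc]
  rw [mul_nonsing_inv_cancel_left _ _ hG', mul_nonsing_inv _ hG', Matrix.mul_one]

end Congruence

/-! ### The Schur complement of the first pivot -/

section Schur

variable {ι : Type*}

/-- The Schur complement of the entry with index `Sum.inl ()`. -/
def schurCompl (X : Matrix (Unit ⊕ ι) (Unit ⊕ ι) ℝ) : Matrix ι ι ℝ :=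
  Matrix.of fun i j => X (.inr i) (.inr j) -
    X (.inr i) (.inl ()) * X (.inl ()) (.inr j) / X (.inl ()) (.inl ())

/-- The derivative of `schurCompl` at `X` in the direction `S`. -/
def schurComplDeriv (X S : Matrix (Unit ⊕ ι) (Unit ⊕ ι) ℝ) : Matrix ι ι ℝ :=
  Matrix.of fun i j => S (.inr i) (.inr j) -
    ((S (.inr i) (.inl ()) * X (.inl ()) (.inr j) + X (.inr i) (.inl ()) * S (.inl ()) (.inr j)) *
        X (.inl ()) (.inl ()) -
      X (.inr i) (.inl ()) * X (.inl ()) (.inr j) * S (.inl ()) (.inl ())) /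
        X (.inl ()) (.inl ()) ^ 2

theorem schurCompl_diagonal [DecidableEq ι] (d : Unit ⊕ ι → ℝ) :
    schurCompl (diagonal d) = diagonal (fun i => d (.inr i)) := by
  ext i j
  by_cases h : i = j <;> simp [schurCompl, h, diagonal_apply]

theorem hasDerivWithinAt_schurCompl {P : ℝ → Matrix (Unit ⊕ ι) (Unit ⊕ ι) ℝ}
    {S : Matrix (Unit ⊕ ι) (Unit ⊕ ι) ℝ} {s : Set ℝ} {t : ℝ}
    (hp : P t (.inl ()) (.inl ()) ≠ 0)
    (hP : ∀ i j, HasDerivWithinAt (fun τ => P τ i j) (S i j) s t) (i j : ι) :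
    HasDerivWithinAt (fun τ => schurCompl (P τ) i j) (schurComplDeriv (P t) S i j) s t :=
  (hP _ _).fun_sub (((hP _ _).fun_mul (hP _ _)).fun_div (hP _ _) hp)

variable [Fintype ι] [DecidableEq ι]

/-- The unit lower triangular matrix that eliminates the first column of `X`. -/
def elimMatrix (X : Matrix (Unit ⊕ ι) (Unit ⊕ ι) ℝ) : Matrix (Unit ⊕ ι) (Unit ⊕ ι) ℝ :=
  fromBlocks 1 0 (Matrix.of fun i _ => X (.inr i) (.inl ()) / X (.inl ()) (.inl ())) 1

theorem det_elimMatrix (X : Matrix (Unit ⊕ ι) (Unit ⊕ ι) ℝ) : (elimMatrix X).det = 1 := by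
  simp [elimMatrix]

theorem eq_elimMatrix_mul {X : Matrix (Unit ⊕ ι) (Unit ⊕ ι) ℝ} (hX : X.IsSymm)
    (hp : X (.inl ()) (.inl ()) ≠ 0) :
    X = elimMatrix X *
      fromBlocks (Matrix.of fun _ _ : Unit => X (.inl ()) (.inl ())) 0 0 (schurCompl X) *
      (elimMatrix X)ᵀ := by
  rw [elimMatrix, fromBlocks_transpose, fromBlocks_multiply, fromBlocks_multiply]
  ext (i | i) (j | j)
  · simp
  · simp [Matrix.mul_apply]
    rw [hX.apply]
    field_simp
  · simp [Matrix.mul_apply]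
    field_simp
  · simp [Matrix.mul_apply, schurCompl]
    rw [hX.apply (.inr j) (.inl ())]
    field_simp
    ring

theorem eq_elimMatrix_mul_deriv {X S : Matrix (Unit ⊕ ι) (Unit ⊕ ι) ℝ} (hX : X.IsSymm)
    (hS : S.IsSymm) (hp : X (.inl ()) (.inl ()) ≠ 0) :
    ∃ q : Matrix ι Unit ℝ, S = elimMatrix X *
      fromBlocks (Matrix.of fun _ _ : Unit => S (.inl ()) (.inl ())) qᵀ q (schurComplDeriv X S) *
      (elimMatrix X)ᵀ := by
  refine ⟨Matrix.of fun i _ => S (.inr i) (.inl ()) -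
    X (.inr i) (.inl ()) / X (.inl ()) (.inl ()) * S (.inl ()) (.inl ()), ?_⟩
  rw [elimMatrix, fromBlocks_transpose, fromBlocks_multiply, fromBlocks_multiply]
  ext (i | i) (j | j)
  · simp
  · simp [Matrix.mul_apply]
    rw [hS.apply]
    ring
  · simp [Matrix.mul_apply]
  · simp [Matrix.mul_apply, schurComplDeriv]
    rw [hX.apply (.inr j) (.inl ()), hS.apply (.inr j) (.inl ())]
    field_simp
    ring

theorem posDef_schurCompl {X : Matrix (Unit ⊕ ι) (Unit ⊕ ι) ℝ} (hX : X.PosDef) :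
    (schurCompl X).PosDef := by
  have hp : X (.inl ()) (.inl ()) ≠ 0 := hX.diag_pos.ne'
  have hS : X.IsSymm := hX.isHermitian
  have h := eq_elimMatrix_mul hS hp
  have hu : IsUnit (elimMatrix X) := by
    rw [isUnit_iff_isUnit_det, det_elimMatrix]; exact isUnit_one
  rw [h] at hX
  have h2 := (Matrix.IsUnit.posDef_star_right_conjugate_iff hu).1 hX
  exact h2.submatrix Sum.inr_injective

theorem det_eq_mul_det_schurCompl {X : Matrix (Unit ⊕ ι) (Unit ⊕ ι) ℝ} (hX : X.PosDef) :
    X.det = X (.inl ()) (.inl ()) * (schurCompl X).det := by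
  conv_lhs => rw [eq_elimMatrix_mul (X := X) hX.isHermitian hX.diag_pos.ne']
  simp [det_mul, det_elimMatrix]

/-- The splitting of both traces into the parts from the first pivot and from the Schur complement.
In the second one the off-diagonal block contributes `2 p⁻¹ tr(qᵀ Y⁻¹ q) ≥ 0`, which is dropped. -/
theorem trace_inv_mul_schur {X S : Matrix (Unit ⊕ ι) (Unit ⊕ ι) ℝ} (hX : X.PosDef)
    (hS : S.IsSymm) :
    (X⁻¹ * S).trace = S (.inl ()) (.inl ()) / X (.inl ()) (.inl ()) +
        ((schurCompl X)⁻¹ * schurComplDeriv X S).trace ∧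
      (S (.inl ()) (.inl ()) / X (.inl ()) (.inl ())) ^ 2 +
        ((schurCompl X)⁻¹ * schurComplDeriv X S * (schurCompl X)⁻¹ * schurComplDeriv X S).trace ≤
      (X⁻¹ * S * X⁻¹ * S).trace := by
  have hp : 0 < X (.inl ()) (.inl ()) := hX.diag_pos
  have hX' : X.IsSymm := hX.isHermitian
  obtain ⟨q, hq⟩ := eq_elimMatrix_mul_deriv hX' hS hp.ne'
  have hXe := eq_elimMatrix_mul hX' hp.ne'
  have hY := posDef_schurCompl hX
  have hdet : IsUnit (elimMatrix X).det := by rw [det_elimMatrix]; exact isUnit_one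
  set p := X (.inl ()) (.inl ())
  set σ := S (.inl ()) (.inl ())
  set Y := schurCompl X
  set T := schurComplDeriv X S
  set G := elimMatrix X
  have hinv : (fromBlocks (Matrix.of fun _ _ : Unit => p) 0 0 Y)⁻¹ =
      fromBlocks (Matrix.of fun _ _ : Unit => p⁻¹) 0 0 Y⁻¹ := by
    apply inv_eq_right_inv
    rw [fromBlocks_multiply]
    have : (Matrix.of fun _ _ : Unit => p) * (Matrix.of fun _ _ : Unit => p⁻¹) = 1 := by
      ext i j; simp [Matrix.mul_apply, hp.ne']
    simp [this, mul_nonsing_inv _ ((isUnit_iff_isUnit_det _).1 hY.isUnit)]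
  rw [hXe, hq, trace_inv_mul_congr hdet, trace_inv_mul_inv_mul_congr hdet, hinv,
    Matrix.mul_assoc _ _ (fromBlocks _ qᵀ q T), fromBlocks_multiply, fromBlocks_multiply]
  have hq0 : 0 ≤ (qᵀ * Y⁻¹ * q).trace := by
    have := (hY.inv.posSemidef.conjTranspose_mul_mul_same q).trace_nonneg
    simpa using this
  have e1 : ((Matrix.of fun _ _ : Unit => p⁻¹) * (Matrix.of fun _ _ : Unit => σ)) =
      (Matrix.of fun _ _ : Unit => σ / p) := by
    ext; simp [Matrix.mul_apply]; ring
  have e2 : ((Matrix.of fun _ _ : Unit => p⁻¹) * qᵀ) = p⁻¹ • qᵀ := by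
    ext; simp [Matrix.mul_apply]
  constructor
  · simp [trace_fromBlocks, e1]
    simp [Matrix.trace]
  · simp only [Matrix.zero_mul, zero_add, add_zero, e1, e2, trace_fromBlocks, trace_add]
    have h1 : ((Matrix.of fun _ _ : Unit => σ / p) * (Matrix.of fun _ _ : Unit => σ / p)).trace
        = (σ / p) ^ 2 := by
      simp [Matrix.trace, Matrix.mul_apply]; ring
    have h2 : (p⁻¹ • qᵀ * (Y⁻¹ * q)).trace = p⁻¹ * (qᵀ * Y⁻¹ * q).trace := by
      simp [Matrix.mul_assoc]
    have h3 : (Y⁻¹ * q * p⁻¹ • qᵀ).trace = p⁻¹ * (qᵀ * Y⁻¹ * q).trace := by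
      rw [trace_mul_comm]; simp [Matrix.mul_assoc]
    rw [h1, h2, h3, ← Matrix.mul_assoc]
    have : 0 ≤ p⁻¹ * (qᵀ * Y⁻¹ * q).trace := mul_nonneg (inv_nonneg.2 hp.le) hq0
    linarith

end Schur

/-! ### Logarithms of pivots -/

/-- `x` maps a matrix to coordinates `x X : ι → ℝ` which restrict to the logarithms of the
diagonal entries on diagonal matrices, add up to the logarithm of the determinant, and along a
curve of positive-definite matrices move no faster than the curve does in the affine-invariant
metric. The logarithms of the diagonal part of the `LDLᵀ` decomposition have these properties. -/
structure IsLogPivots {ι : Type*} [Fintype ι] [DecidableEq ι]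
    (x : Matrix ι ι ℝ → ι → ℝ) : Prop where
  diagonal_exp : ∀ d : ι → ℝ, x (diagonal fun i => Real.exp (d i)) = d
  det_eq : ∀ X : Matrix ι ι ℝ, X.PosDef → X.det = Real.exp (∑ i, x X i)
  deriv : ∀ (P : ℝ → Matrix ι ι ℝ) (S : Matrix ι ι ℝ) (s : Set ℝ) (t : ℝ), (P t).PosDef →
    S.IsSymm → (∀ i j, HasDerivWithinAt (fun τ => P τ i j) (S i j) s t) →
    ∃ v : ι → ℝ, (∀ i, HasDerivWithinAt (fun τ => x (P τ) i) (v i) s t) ∧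
      ∑ i, v i = ((P t)⁻¹ * S).trace ∧ ∑ i, v i ^ 2 ≤ ((P t)⁻¹ * S * (P t)⁻¹ * S).trace

theorem isLogPivots_of_isEmpty {ι : Type*} [Fintype ι] [DecidableEq ι] [IsEmpty ι] :
    IsLogPivots (fun (_ : Matrix ι ι ℝ) (_ : ι) => (0 : ℝ)) where
  diagonal_exp d := Subsingleton.elim _ _
  det_eq X _ := by simp
  deriv P S s t _ _ _ := ⟨0, by simp, by simp [Matrix.trace], by simp [Matrix.trace]⟩

/-- The first coordinate is the logarithm of the first pivot, the others are those of the Schur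
complement. -/
theorem IsLogPivots.sum_unit {ι : Type*} [Fintype ι] [DecidableEq ι] {x : Matrix ι ι ℝ → ι → ℝ}
    (hx : IsLogPivots x) :
    IsLogPivots (fun (X : Matrix (Unit ⊕ ι) (Unit ⊕ ι) ℝ) =>
      Sum.elim (fun _ => Real.log (X (.inl ()) (.inl ()))) (x (schurCompl X))) where
  diagonal_exp d := by
    rw [schurCompl_diagonal, hx.diagonal_exp]
    ext (i | i) <;> simp
  det_eq X hX := by
    rw [det_eq_mul_det_schurCompl hX, hx.det_eq _ (posDef_schurCompl hX)]
    simp [Real.exp_add, Real.exp_log (hX.diag_pos (i := .inl ()))]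
  deriv P S s t hP hS hd := by
    have hp : 0 < P t (.inl ()) (.inl ()) := hP.diag_pos
    have hT : (schurComplDeriv (P t) S).IsSymm := by
      ext i j
      have h1 : (P t).IsSymm := hP.isHermitian
      simp only [schurComplDeriv, transpose_apply, of_apply]
      rw [hS.apply (.inr i) (.inr j), hS.apply (.inl ()) (.inr j), hS.apply (.inr i) (.inl ()),
        h1.apply (.inl ()) (.inr j), h1.apply (.inr i) (.inl ())]
      ring
    obtain ⟨v, hv, hv1, hv2⟩ := hx.deriv (fun τ => schurCompl (P τ)) (schurComplDeriv (P t) S) s t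
      (posDef_schurCompl hP) hT (hasDerivWithinAt_schurCompl hp.ne' hd)
    obtain ⟨h1, h2⟩ := trace_inv_mul_schur hP hS
    refine ⟨Sum.elim (fun _ => S (.inl ()) (.inl ()) / P t (.inl ()) (.inl ())) v, ?_, ?_, ?_⟩
    · rintro (i | i)
      · exact (hd _ _).log hp.ne'
      · exact hv i
    · simp [h1, hv1]
    · simp only [Fintype.sum_sum_type, Sum.elim_inl, Sum.elim_inr, Finset.univ_unique,
        Finset.sum_singleton]
      linarith

theorem IsLogPivots.reindex {ι κ : Type*} [Fintype ι] [DecidableEq ι] [Fintype κ] [DecidableEq κ]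
    (e : κ ≃ ι) {x : Matrix ι ι ℝ → ι → ℝ} (hx : IsLogPivots x) :
    IsLogPivots (fun (X : Matrix κ κ ℝ) k => x (X.submatrix e.symm e.symm) (e k)) where
  diagonal_exp d := by
    have := hx.diagonal_exp (d ∘ e.symm)
    ext k
    rw [submatrix_diagonal_equiv]
    simpa [Function.comp_def] using congrFun this (e k)
  det_eq X hX := by
    rw [← det_submatrix_equiv_self e.symm, hx.det_eq _ (hX.submatrix e.symm.injective),
      e.sum_comp]
  deriv P S s t hP hS hd := by
    obtain ⟨v, hv, hv1, hv2⟩ := hx.deriv (fun τ => (P τ).submatrix e.symm e.symm)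
      (S.submatrix e.symm e.symm) s t (hP.submatrix e.symm.injective) (hS.submatrix _)
      (fun i j => hd _ _)
    refine ⟨v ∘ e, fun i => hv _, ?_, ?_⟩
    · rw [inv_submatrix_equiv, submatrix_mul_equiv, trace_submatrix_self_equiv] at hv1
      rw [← hv1]; exact e.sum_comp v
    · rw [inv_submatrix_equiv, submatrix_mul_equiv, submatrix_mul_equiv, submatrix_mul_equiv,
        trace_submatrix_self_equiv] at hv2
      exact (e.sum_comp (fun i => v i ^ 2)).trans_le hv2

theorem exists_isLogPivots (n : ℕ) : ∃ x : Matrix (Fin n) (Fin n) ℝ → Fin n → ℝ, IsLogPivots x := by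
  induction n with
  | zero => exact ⟨_, isLogPivots_of_isEmpty⟩
  | succ n ih =>
    obtain ⟨x, hx⟩ := ih
    exact ⟨_, hx.sum_unit.reindex (Fintype.equivOfCardEq (by simp [add_comm]))⟩

/-! ### Lengths of curves -/

variable {n : ℕ}

section Curves

variable {A B : Matrix (Fin n) (Fin n) ℝ} {P : ℝ → Matrix (Fin n) (Fin n) ℝ}

theorem velocity_eq {S : Matrix (Fin n) (Fin n) ℝ} {t : ℝ} (ht : t ∈ Set.Icc (0 : ℝ) 1)
    (h : ∀ i j, HasDerivWithinAt (fun τ => P τ i j) (S i j) (Set.Icc 0 1) t) :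
    velocity P t = S := by
  ext i j
  exact (h i j).derivWithin (uniqueDiffOn_Icc zero_lt_one t ht)

theorem IsCurve.hasDerivWithinAt (hP : IsCurve A B P) {t : ℝ} (ht : t ∈ Set.Icc (0 : ℝ) 1)
    (i j : Fin n) :
    HasDerivWithinAt (fun τ => P τ i j) (velocity P t i j) (Set.Icc 0 1) t :=
  ((hP.contDiffOn i j).differentiableOn (by norm_num) t ht).hasDerivWithinAt

theorem IsCurve.isSymm_velocity (hP : IsCurve A B P) {t : ℝ} (ht : t ∈ Set.Icc (0 : ℝ) 1) :
    (velocity P t).IsSymm := by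
  ext i j
  have h : ∀ τ ∈ Set.Icc (0 : ℝ) 1, P τ j i = P τ i j := fun τ hτ =>
    IsSymm.apply (hP.posDef τ hτ).isHermitian i j
  exact derivWithin_congr h (h t ht)

theorem IsCurve.intervalIntegrable (hP : IsCurve A B P) (β : ℝ) :
    IntervalIntegrable (fun t => Real.sqrt (metric β (P t) (velocity P t) (velocity P t)))
      MeasureTheory.volume 0 1 := by
  apply ContinuousOn.intervalIntegrable
  rw [Set.uIcc_of_le zero_le_one, continuousOn_iff_continuous_domRestrict]
  have hc : Continuous fun t : Set.Icc (0 : ℝ) 1 => P t :=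
    continuous_matrix fun i j =>
      continuousOn_iff_continuous_domRestrict.1 (hP.contDiffOn i j).continuousOn
  have hv : Continuous fun t : Set.Icc (0 : ℝ) 1 => velocity P t :=
    continuous_matrix fun i j => continuousOn_iff_continuous_domRestrict.1
      ((hP.contDiffOn i j).continuousOn_derivWithin (uniqueDiffOn_Icc zero_lt_one) (by norm_num))
  have hd : ∀ t : Set.Icc (0 : ℝ) 1, (P t).det ≠ 0 := fun t => (hP.posDef t t.2).det_pos.ne'
  have hi : Continuous fun t : Set.Icc (0 : ℝ) 1 => (P t)⁻¹ := by
    simp only [inv_def, Ring.inverse_eq_inv']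
    exact (hc.matrix_det.inv₀ hd).smul hc.matrix_adjugate
  unfold metric
  exact ((hc.matrix_det.rpow_const fun t => .inl (hd t)).mul
    ((((hi.matrix_mul hv).matrix_mul hi).matrix_mul hv).matrix_trace.sub
      ((continuous_const.mul (hi.matrix_mul hv).matrix_trace).mul
        (hi.matrix_mul hv).matrix_trace))).sqrt

theorem length_nonneg (β : ℝ) (P : ℝ → Matrix (Fin n) (Fin n) ℝ) : 0 ≤ length β P :=
  intervalIntegral.integral_nonneg zero_le_one fun _ _ => Real.sqrt_nonneg _

/-- A function on `Fin n → ℝ` whose gradient is at most one in the metric of diagonal matrices is,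
as a function of the logarithms of the pivots, 1-Lipschitz on positive-definite matrices. -/
theorem IsLogPivots.sub_le_length {x : Matrix (Fin n) (Fin n) ℝ → Fin n → ℝ} (hx : IsLogPivots x)
    {β : ℝ} {f : (Fin n → ℝ) → ℝ} {f' : (Fin n → ℝ) → (Fin n → ℝ) →L[ℝ] ℝ}
    (hf : ∀ y, HasFDerivAt f (f' y) y)
    (hf' : ∀ y v, f' y v ≤
      Real.sqrt (Real.exp (∑ i, y i) ^ β * (∑ i, v i ^ 2 - β * (∑ i, v i) * ∑ i, v i)))
    (hP : IsCurve A B P) : f (x B) - f (x A) ≤ length β P := by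
  have key : ∀ t ∈ Set.Icc (0 : ℝ) 1, ∃ d,
      HasDerivWithinAt (fun τ => f (x (P τ))) d (Set.Icc 0 1) t ∧
      d ≤ Real.sqrt (metric β (P t) (velocity P t) (velocity P t)) := by
    intro t ht
    obtain ⟨v, hv, hv1, hv2⟩ := hx.deriv P (velocity P t) (Set.Icc 0 1) t (hP.posDef t ht)
      (hP.isSymm_velocity ht) (hP.hasDerivWithinAt ht)
    refine ⟨f' (x (P t)) v,
      (hf (x (P t))).comp_hasDerivWithinAt t (hasDerivWithinAt_pi.2 hv), ?_⟩
    refine (hf' _ _).trans (Real.sqrt_le_sqrt ?_)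
    rw [metric, hx.det_eq _ (hP.posDef t ht), ← hv1]
    gcongr
  -- only the bound has to be integrable, the derivative `d` itself need not be
  choose! d hd hd' using key
  have := intervalIntegral.sub_le_integral_of_hasDeriv_right_of_le (zero_le_one (α := ℝ))
    (g := fun τ => f (x (P τ))) (g' := d) (fun t ht => (hd t ht).continuousWithinAt)
    (fun t ht => ((hd t (Set.Ioo_subset_Icc_self ht)).hasDerivAt
      (Icc_mem_nhds ht.1 ht.2)).hasDerivWithinAt)
    ((intervalIntegrable_iff_integrableOn_Icc_of_le zero_le_one).1 (hP.intervalIntegrable β))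
    (fun t ht => hd' t (Set.Ioo_subset_Icc_self ht))
  simpa only [hP.source, hP.target, length] using this

theorem riemannianDist_le (β : ℝ) (hP : IsCurve A B P) : riemannianDist β A B ≤ length β P :=
  csInf_le ⟨0, by rintro L ⟨P, -, rfl⟩; exact length_nonneg β P⟩ ⟨P, hP, rfl⟩

/-! ### Diagonal curves -/

theorem isCurve_diagonal {y : ℝ → Fin n → ℝ}
    (hy : ∀ i, ContDiffOn ℝ 2 (fun t => y t i) (Set.Icc 0 1)) :
    IsCurve (diagonal fun i => Real.exp (y 0 i)) (diagonal fun i => Real.exp (y 1 i))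
      (fun t => diagonal fun i => Real.exp (y t i)) where
  contDiffOn i j := by
    by_cases h : i = j
    · subst h; simpa using (hy i).exp
    · simpa [h] using contDiffOn_const
  posDef t _ := PosDef.diagonal fun i => Real.exp_pos _
  source := rfl
  target := rfl

/-- The metric on diagonal matrices, in logarithmic coordinates. -/
theorem metric_diagonal (β : ℝ) (y v : Fin n → ℝ) :
    metric β (diagonal fun i => Real.exp (y i)) (diagonal fun i => Real.exp (y i) * v i)
      (diagonal fun i => Real.exp (y i) * v i) =
    Real.exp (∑ i, y i) ^ β * (∑ i, v i ^ 2 - β * (∑ i, v i) * ∑ i, v i) := by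
  have hinv : (diagonal fun i => Real.exp (y i))⁻¹ = diagonal fun i => Real.exp (-y i) := by
    apply inv_eq_right_inv
    simp [← Real.exp_add]
  have h : ∀ i, Real.exp (-y i) * (Real.exp (y i) * v i) = v i := fun i => by
    rw [← mul_assoc, ← Real.exp_add]; simp
  rw [metric, Matrix.mul_assoc _ _ (diagonal fun i => Real.exp (y i) * v i), hinv]
  simp [h, Real.exp_sum, sq, trace_diagonal]

/-- A curve of diagonal matrices with speed at most `C` has length at most `C`. -/
theorem length_diagonal_le {β C : ℝ} {y v : ℝ → Fin n → ℝ}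
    (hy : ∀ t ∈ Set.Icc (0 : ℝ) 1, ∀ i, HasDerivWithinAt (fun τ => y τ i) (v t i) (Set.Icc 0 1) t)
    (hC : ∀ t ∈ Set.Icc (0 : ℝ) 1, Real.sqrt (Real.exp (∑ i, y t i) ^ β *
      (∑ i, v t i ^ 2 - β * (∑ i, v t i) * ∑ i, v t i)) ≤ C) :
    length β (fun t => diagonal fun i => Real.exp (y t i)) ≤ C := by
  have := intervalIntegral.norm_integral_le_of_norm_le_const (a := 0) (b := 1) (C := C)
    (f := fun t => Real.sqrt (metric β ((fun t => diagonal fun i => Real.exp (y t i)) t)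
      (velocity (fun t => diagonal fun i => Real.exp (y t i)) t)
      (velocity (fun t => diagonal fun i => Real.exp (y t i)) t))) ?_
  · simpa [length] using (le_abs_self _).trans this
  · intro t ht
    rw [Set.uIoc_of_le zero_le_one] at ht
    have ht' := Set.Ioc_subset_Icc_self ht
    rw [velocity_eq (S := diagonal fun i => Real.exp (y t i) * v t i) ht', metric_diagonal,
      Real.norm_of_nonneg (Real.sqrt_nonneg _)]
    · exact hC t ht'
    · intro i j
      by_cases h : i = j
      · subst h; simpa using (hy t ht' i).exp
      · simpa [h] using hasDerivWithinAt_const t (Set.Icc 0 1) (0 : ℝ)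

/-! ### Congruence invariance -/

theorem metric_congr (β : ℝ) (G : Matrix (Fin n) (Fin n) ℝ) (hG : IsUnit G.det)
    {X : Matrix (Fin n) (Fin n) ℝ} (hX : 0 ≤ X.det) (S T : Matrix (Fin n) (Fin n) ℝ) :
    metric β (G * X * Gᵀ) (G * S * Gᵀ) (G * T * Gᵀ) = (|G.det| ^ β) ^ 2 * metric β X S T := by
  rw [metric, metric, trace_inv_mul_inv_mul_congr hG, trace_inv_mul_congr hG,
    trace_inv_mul_congr hG]
  have : (G * X * Gᵀ).det = |G.det| * |G.det| * X.det := by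
    rw [abs_mul_abs_self, det_mul, det_mul, det_transpose]; ring
  rw [this, Real.mul_rpow (by positivity) hX, Real.mul_rpow (abs_nonneg _) (abs_nonneg _)]
  ring

theorem IsCurve.congr (hP : IsCurve A B P) {G : Matrix (Fin n) (Fin n) ℝ} (hG : IsUnit G.det) :
    IsCurve (G * A * Gᵀ) (G * B * Gᵀ) (fun t => G * P t * Gᵀ) where
  contDiffOn i j := by
    simp only [Matrix.mul_apply]
    exact ContDiffOn.sum fun k _ =>
      (ContDiffOn.sum fun l _ => contDiffOn_const.mul (hP.contDiffOn l k)).mul contDiffOn_const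
  posDef t ht :=
    (Matrix.IsUnit.posDef_star_right_conjugate_iff ((isUnit_iff_isUnit_det G).2 hG)).2
      (hP.posDef t ht)
  source := by rw [hP.source]
  target := by rw [hP.target]

theorem IsCurve.length_congr (hP : IsCurve A B P) (β : ℝ) {G : Matrix (Fin n) (Fin n) ℝ}
    (hG : IsUnit G.det) :
    length β (fun t => G * P t * Gᵀ) = |G.det| ^ β * length β P := by
  rw [length, length, ← intervalIntegral.integral_const_mul]
  apply intervalIntegral.integral_congr
  intro t ht
  rw [Set.uIcc_of_le zero_le_one] at ht
  have hv : velocity (fun t => G * P t * Gᵀ) t = G * velocity P t * Gᵀ := by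
    refine velocity_eq ht fun i j => ?_
    simp only [Matrix.mul_apply]
    exact HasDerivWithinAt.fun_sum fun k _ =>
      (HasDerivWithinAt.fun_sum fun l _ =>
        (hP.hasDerivWithinAt ht l k).const_mul _).mul_const _
  simp only [hv]
  rw [metric_congr β G hG (hP.posDef t ht).det_pos.le,
    Real.sqrt_mul (by positivity), Real.sqrt_sq (by positivity)]

theorem riemannianDist_congr (β : ℝ) {G : Matrix (Fin n) (Fin n) ℝ} (hG : IsUnit G.det)
    (A B : Matrix (Fin n) (Fin n) ℝ) :
    riemannianDist β (G * A * Gᵀ) (G * B * Gᵀ) = |G.det| ^ β * riemannianDist β A B := by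
  rw [riemannianDist, riemannianDist, ← smul_eq_mul (|G.det| ^ β),
    ← Real.sInf_smul_of_nonneg (by positivity)]
  congr 1
  ext L
  rw [Set.mem_smul_set]
  constructor
  · rintro ⟨P, hP, rfl⟩
    have hG' : IsUnit G⁻¹.det := (isUnit_nonsing_inv_det_iff).2 hG
    have hG't : IsUnit Gᵀ.det := by rwa [det_transpose]
    have hinv : ∀ X, G⁻¹ * (G * X * Gᵀ) * G⁻¹ᵀ = X := fun X => by
      rw [transpose_nonsing_inv, Matrix.mul_assoc, mul_nonsing_inv_cancel_right _ _ hG't,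
        nonsing_inv_mul_cancel_left _ _ hG]
    have hQ := hP.congr hG'
    rw [hinv, hinv] at hQ
    refine ⟨_, ⟨_, hQ, rfl⟩, ?_⟩
    have h1 : |G.det| ≠ 0 := abs_ne_zero.2 hG.ne_zero
    rw [hP.length_congr β hG', smul_eq_mul, ← mul_assoc, ← Real.mul_rpow (abs_nonneg _)
      (abs_nonneg _), ← abs_mul, ← det_mul, mul_nonsing_inv _ hG]
    simp
  · rintro ⟨_, ⟨P, hP, rfl⟩, rfl⟩
    exact ⟨_, hP.congr hG, (hP.length_congr β hG).symm⟩

end Curves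

/-! ### The distance from the identity to a diagonal matrix -/

/-- The Euclidean norm of `a` minus its mean: the norm of the trace-free part of `diagonal a`. -/
def traceFreeNorm (a : Fin n → ℝ) : ℝ := Real.sqrt (∑ i, (a i - (∑ j, a j) / n) ^ 2)

/-- The vector `a` minus its mean, scaled to Euclidean norm one; it is zero if `a` is constant. -/
def traceFreeDir (a : Fin n → ℝ) (i : Fin n) : ℝ := (a i - (∑ j, a j) / n) / traceFreeNorm a

theorem sq_traceFreeNorm (a : Fin n → ℝ) :
    traceFreeNorm a ^ 2 = ∑ i, (a i - (∑ j, a j) / n) ^ 2 :=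
  Real.sq_sqrt (Finset.sum_nonneg fun _ _ => sq_nonneg _)

theorem sum_sub_mean (hn : n ≠ 0) (a : Fin n → ℝ) : ∑ i, (a i - (∑ j, a j) / n) = 0 := by
  have : (n : ℝ) ≠ 0 := Nat.cast_ne_zero.2 hn
  simp [Finset.sum_sub_distrib]
  field_simp
  simp

theorem sum_traceFreeDir (hn : n ≠ 0) (a : Fin n → ℝ) : ∑ i, traceFreeDir a i = 0 := by
  simp only [traceFreeDir]
  rw [← Finset.sum_div, sum_sub_mean hn, zero_div]

theorem sum_sq_traceFreeDir_le (a : Fin n → ℝ) : ∑ i, traceFreeDir a i ^ 2 ≤ 1 := by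
  simp only [traceFreeDir, div_pow]
  rw [← Finset.sum_div, ← sq_traceFreeNorm]
  exact div_self_le_one _

theorem traceFreeNorm_mul_traceFreeDir (a : Fin n → ℝ) (i : Fin n) :
    traceFreeNorm a * traceFreeDir a i = a i - (∑ j, a j) / n := by
  by_cases h : traceFreeNorm a = 0
  · have h2 := sq_traceFreeNorm a
    rw [h, sq, mul_zero, eq_comm, Finset.sum_eq_zero_iff_of_nonneg fun _ _ => sq_nonneg _] at h2
    rw [h, zero_mul, pow_eq_zero_iff two_ne_zero |>.1 (h2 i (Finset.mem_univ i))]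
  · rw [traceFreeDir]; field_simp

theorem sum_traceFreeDir_mul (hn : n ≠ 0) (a : Fin n → ℝ) :
    ∑ i, traceFreeDir a i * a i = traceFreeNorm a := by
  have h1 : ∑ i, traceFreeDir a i * a i = ∑ i, (a i - (∑ j, a j) / n) ^ 2 / traceFreeNorm a := by
    have : ∑ i, traceFreeDir a i * ((∑ j, a j) / n) = 0 := by
      rw [← Finset.sum_mul, sum_traceFreeDir hn, zero_mul]
    rw [← sub_zero (∑ i, traceFreeDir a i * a i), ← this, ← Finset.sum_sub_distrib]
    refine Finset.sum_congr rfl fun i _ => ?_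
    rw [traceFreeDir]; ring
  rw [h1, ← Finset.sum_div, ← sq_traceFreeNorm, sq, mul_self_div_self]

theorem sum_sq_eq (hn : n ≠ 0) (a : Fin n → ℝ) :
    ∑ i, a i ^ 2 = (∑ i, a i) ^ 2 / n + traceFreeNorm a ^ 2 := by
  have h0 : (n : ℝ) ≠ 0 := Nat.cast_ne_zero.2 hn
  have hm := sum_sub_mean hn a
  have hs : ∑ j, a j = n * ((∑ j, a j) / n) := by field_simp
  rw [sq_traceFreeNorm]
  generalize (∑ j, a j) / (n : ℝ) = m at hm hs ⊢
  have h1 : ∀ i, a i ^ 2 = (a i - m) ^ 2 + 2 * m * (a i - m) + m ^ 2 := fun i => by ring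
  rw [Finset.sum_congr rfl fun i _ => h1 i, Finset.sum_add_distrib, Finset.sum_add_distrib,
    ← Finset.mul_sum, hm, hs, Finset.sum_const, Finset.card_univ, Fintype.card_fin, nsmul_eq_mul]
  field_simp
  ring

/-- Bessel's inequality for the constant vectors and a vector `u` orthogonal to them. -/
theorem sq_sum_div_add_sq_le (hn : n ≠ 0) {u : Fin n → ℝ} (hu0 : ∑ i, u i = 0)
    (hu1 : ∑ i, u i ^ 2 ≤ 1) (v : Fin n → ℝ) :
    (∑ i, v i) ^ 2 / n + (∑ i, u i * v i) ^ 2 ≤ ∑ i, v i ^ 2 := by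
  rw [sum_sq_eq hn v, sq_traceFreeNorm]
  have h1 : ∑ i, u i * v i = ∑ i, u i * (v i - (∑ j, v j) / n) := by
    simp only [mul_sub, Finset.sum_sub_distrib, ← Finset.sum_mul, hu0]
    simp
  have h2 := Finset.sum_mul_sq_le_sq_mul_sq Finset.univ u (fun i => v i - (∑ j, v j) / n)
  rw [← h1] at h2
  have h3 : (∑ i, u i ^ 2) * ∑ i, (v i - (∑ j, v j) / n) ^ 2 ≤
      ∑ i, (v i - (∑ j, v j) / n) ^ 2 :=
    mul_le_of_le_one_left (Finset.sum_nonneg fun _ _ => sq_nonneg _) hu1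
  linarith

/-- The metric `g^β` is that of a cone over the unimodular matrices; `coneRadius n β` is the
distance from the apex to a matrix of determinant one. -/
def coneRadius (n : ℕ) (β : ℝ) : ℝ := 2 * Real.sqrt (1 / (n : ℝ) - β) / |β|

theorem coneRadius_pos {β : ℝ} (h0 : β ≠ 0) (h1 : β < 1 / (n : ℝ)) : 0 < coneRadius n β := by
  have : 0 < Real.sqrt (1 / (n : ℝ) - β) := Real.sqrt_pos.2 (by linarith)
  have := abs_pos.2 h0
  unfold coneRadius
  positivity

theorem sq_coneRadius_mul {β : ℝ} (h0 : β ≠ 0) (h1 : β < 1 / (n : ℝ)) :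
    coneRadius n β ^ 2 * (β / 2) ^ 2 = 1 / n - β := by
  rw [coneRadius, div_pow, mul_pow, Real.sq_sqrt (by linarith), sq_abs]
  field_simp

/-- In the plane, the squared distance between the point `1` and the point with polar
coordinates `r`, `γ`. -/
def sqChord (r γ : ℝ) : ℝ := (1 - r) ^ 2 + 4 * r * Real.sin (γ / 2) ^ 2

theorem sqChord_eq (r γ : ℝ) :
    sqChord r γ = (r * Real.cos γ - 1) ^ 2 + (r * Real.sin γ) ^ 2 := by
  have h1 : Real.cos γ = 1 - 2 * Real.sin (γ / 2) ^ 2 := by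
    rw [← Real.cos_sq_add_sin_sq (γ / 2), add_sub_assoc, two_mul, sub_add_cancel_left,
      ← sub_eq_add_neg, ← Real.cos_two_mul', mul_div_cancel₀ _ two_ne_zero]
  have h2 : Real.sin γ ^ 2 = 1 - Real.cos γ ^ 2 := Real.sin_sq γ
  rw [mul_pow, h2, sqChord, h1]
  ring

theorem sqChord_nonneg (r γ : ℝ) : 0 ≤ sqChord r γ := by
  rw [sqChord_eq]; positivity

theorem isCurve_one_diagonal (a : Fin n → ℝ) :
    IsCurve 1 (diagonal fun i => Real.exp (a i)) fun t => diagonal fun i => Real.exp (t * a i) := by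
  have := isCurve_diagonal (y := fun t i => t * a i) fun i =>
    (contDiff_id.mul contDiff_const).contDiffOn
  simpa using this

theorem le_riemannianDist {β C : ℝ} {a : Fin n → ℝ}
    (h : ∀ P, IsCurve 1 (diagonal fun i => Real.exp (a i)) P → C ≤ length β P) :
    C ≤ riemannianDist β 1 (diagonal fun i => Real.exp (a i)) :=
  le_csInf ⟨_, _, isCurve_one_diagonal a, rfl⟩ (by rintro L ⟨P, hP, rfl⟩; exact h P hP)

theorem IsLogPivots.map_one {x : Matrix (Fin n) (Fin n) ℝ → Fin n → ℝ} (hx : IsLogPivots x) :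
    x 1 = 0 := by
  have := hx.diagonal_exp 0
  simpa using this

theorem riemannianDist_zero_one_diagonal (a : Fin n → ℝ) :
    riemannianDist 0 1 (diagonal fun i => Real.exp (a i)) = Real.sqrt (∑ i, a i ^ 2) := by
  set N := Real.sqrt (∑ i, a i ^ 2) with hN
  have hN2 : N ^ 2 = ∑ i, a i ^ 2 := Real.sq_sqrt (Finset.sum_nonneg fun _ _ => sq_nonneg _)
  apply le_antisymm
  · refine (riemannianDist_le 0 (isCurve_one_diagonal a)).trans
      (length_diagonal_le (v := fun _ => a) (fun t _ i => ?_) fun t _ => ?_)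
    · simpa using ((hasDerivAt_id t).mul_const (a i)).hasDerivWithinAt
    · simp [hN]
  · refine le_riemannianDist fun P hP => ?_
    obtain ⟨x, hx⟩ := exists_isLogPivots n
    let f : (Fin n → ℝ) →L[ℝ] ℝ :=
      ∑ i, (a i / N) • (ContinuousLinearMap.proj i : (Fin n → ℝ) →L[ℝ] ℝ)
    have hf : ∀ v, f v = ∑ i, a i / N * v i := fun v => by simp [f]
    have := hx.sub_le_length (β := 0) (f := f) (f' := fun _ => f)
      (fun y => f.hasFDerivAt) (fun y v => ?_) hP
    · rw [hx.diagonal_exp, hx.map_one, map_zero, sub_zero, hf] at this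
      refine le_trans (le_of_eq ?_) this
      have h1 : ∑ i, a i / N * a i = (∑ i, a i ^ 2) / N := by
        rw [Finset.sum_div]; exact Finset.sum_congr rfl fun i _ => by ring
      rw [h1, ← hN2, sq, mul_self_div_self]
    · apply Real.le_sqrt_of_sq_le
      rw [hf]
      refine (Finset.sum_mul_sq_le_sq_mul_sq Finset.univ _ v).trans ?_
      have h1 : ∑ i, (a i / N) ^ 2 ≤ 1 := by
        simp only [div_pow]
        rw [← Finset.sum_div, ← hN2]
        exact div_self_le_one _
      simpa using mul_le_of_le_one_left (Finset.sum_nonneg fun _ _ => sq_nonneg _) h1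

/-- The lower bound: with the radius `c * exp (β / 2 * ∑ y i)` and the angle `(∑ u i * y i) / c` as
polar coordinates, the metric dominates that of the plane, and the coordinate of the plane in the
direction of the chord has gradient at most one. -/
theorem mul_sqrt_sqChord_le_length (hn : n ≠ 0) {β : ℝ} (h0 : β ≠ 0) (h1 : β < 1 / (n : ℝ))
    {a : Fin n → ℝ} {P : ℝ → Matrix (Fin n) (Fin n) ℝ}
    (hP : IsCurve 1 (diagonal fun i => Real.exp (a i)) P) :
    coneRadius n β * Real.sqrt
      (sqChord (Real.exp (β / 2 * ∑ i, a i)) (traceFreeNorm a / coneRadius n β)) ≤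
      length β P := by
  obtain ⟨x, hx⟩ := exists_isLogPivots n
  set c := coneRadius n β with hc
  have hc0 : 0 < c := coneRadius_pos h0 h1
  have hc2 : c ^ 2 * (β / 2) ^ 2 = 1 / n - β := sq_coneRadius_mul h0 h1
  set u := traceFreeDir a with hu
  set γ := traceFreeNorm a / c
  set ρ := Real.exp (β / 2 * ∑ i, a i)
  set N := Real.sqrt (sqChord ρ γ) with hN
  have hN2 : N ^ 2 = (ρ * Real.cos γ - 1) ^ 2 + (ρ * Real.sin γ) ^ 2 := by
    rw [hN, Real.sq_sqrt (sqChord_nonneg _ _), sqChord_eq]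
  -- the unit vector along the chord, which is zero if the chord is a point
  set e₁ := (ρ * Real.cos γ - 1) / N with he₁
  set e₂ := (ρ * Real.sin γ) / N with he₂
  have he : e₁ ^ 2 + e₂ ^ 2 ≤ 1 := by
    rw [he₁, he₂, div_pow, div_pow, ← add_div, ← hN2]; exact div_self_le_one _
  let σ : (Fin n → ℝ) →L[ℝ] ℝ := ∑ i, (ContinuousLinearMap.proj i : (Fin n → ℝ) →L[ℝ] ℝ)
  let w : (Fin n → ℝ) →L[ℝ] ℝ :=
    ∑ i, u i • (ContinuousLinearMap.proj i : (Fin n → ℝ) →L[ℝ] ℝ)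
  have hσ : ∀ v, σ v = ∑ i, v i := fun v => by simp [σ]
  have hw : ∀ v, w v = ∑ i, u i * v i := fun v => by simp [w]
  have hr : ∀ y, HasFDerivAt (fun y => c * Real.exp (β / 2 * σ y))
      (c • Real.exp (β / 2 * σ y) • (β / 2) • σ) y := fun y =>
    ((σ.hasFDerivAt.const_mul (β / 2)).exp).const_mul c
  have hθ : ∀ y, HasFDerivAt (fun y => c⁻¹ * w y) (c⁻¹ • w) y := fun y =>
    w.hasFDerivAt.const_mul c⁻¹
  have hf := fun y => (hr y).fun_mul
    (((hθ y).cos.const_mul e₁).fun_add ((hθ y).sin.const_mul e₂))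
  have key := hx.sub_le_length (β := β) hf (fun y v => ?_) hP
  · refine le_trans (le_of_eq ?_) key
    have h2 : c⁻¹ * w a = γ := by
      rw [hw, sum_traceFreeDir_mul hn]; ring
    rw [hx.diagonal_exp, hx.map_one, h2, hσ]
    have h3 : e₁ * (ρ * Real.cos γ - 1) + e₂ * (ρ * Real.sin γ) = N := by
      rw [he₁, he₂, div_mul_eq_mul_div, div_mul_eq_mul_div, ← sq, ← sq, ← add_div, ← hN2, sq,
        mul_self_div_self]
    simp only [map_zero, mul_zero, Real.exp_zero, Real.cos_zero, Real.sin_zero]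
    linear_combination (-c) * h3
  · apply Real.le_sqrt_of_sq_le
    have h2 := sq_sum_div_add_sq_le hn (sum_traceFreeDir hn a) (sum_sq_traceFreeDir_le a) v
    have h3 : Real.exp (∑ i, y i) ^ β = Real.exp (β / 2 * σ y) ^ 2 := by
      rw [hσ, ← Real.exp_mul, ← Real.exp_nat_mul]; congr 1; push_cast; ring
    rw [h3]
    simp only [_root_.add_apply, _root_.smul_apply, smul_eq_mul]
    set E := Real.exp (β / 2 * σ y)
    set C := Real.cos (c⁻¹ * w y)
    set S := Real.sin (c⁻¹ * w y)
    have hCS : C ^ 2 + S ^ 2 = 1 := Real.cos_sq_add_sin_sq _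
    rw [← hσ v] at h2 ⊢
    rw [← hw] at h2
    -- Cauchy-Schwarz in the plane, and then `|dz|² = dr² + r² dθ²`
    calc _ = E ^ 2 * (e₁ * (c * (β / 2) * σ v * C - w v * S) +
            e₂ * (c * (β / 2) * σ v * S + w v * C)) ^ 2 := by
          field_simp
          ring
      _ ≤ E ^ 2 * ((e₁ ^ 2 + e₂ ^ 2) * ((c * (β / 2) * σ v * C - w v * S) ^ 2 +
            (c * (β / 2) * σ v * S + w v * C) ^ 2)) := by
          gcongr
          nlinarith [sq_nonneg (e₁ * (c * (β / 2) * σ v * S + w v * C) -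
            e₂ * (c * (β / 2) * σ v * C - w v * S))]
      _ ≤ E ^ 2 * (1 * ((c * (β / 2) * σ v * C - w v * S) ^ 2 +
            (c * (β / 2) * σ v * S + w v * C) ^ 2)) := by gcongr
      _ = E ^ 2 * (c ^ 2 * (β / 2) ^ 2 * σ v ^ 2 + w v ^ 2) := by
          linear_combination (E ^ 2 * (c ^ 2 * (β / 2) ^ 2 * σ v ^ 2 + w v ^ 2)) * hCS
      _ ≤ _ := by
          rw [hc2]
          gcongr
          linear_combination h2

/-- The upper bound: a curve of diagonal matrices which in the polar coordinates of
`mul_sqrt_sqChord_le_length` is a line segment. As the angle is less than `π / 2`, the segment stays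
in the right half plane, where the logarithm is smooth. -/
theorem exists_isCurve_length_le (hn : n ≠ 0) {β : ℝ} (h0 : β ≠ 0) (h1 : β < 1 / (n : ℝ))
    {a : Fin n → ℝ} (hγ : traceFreeNorm a / coneRadius n β < Real.pi / 2) :
    ∃ P, IsCurve 1 (diagonal fun i => Real.exp (a i)) P ∧ length β P ≤
      coneRadius n β * Real.sqrt
        (sqChord (Real.exp (β / 2 * ∑ i, a i)) (traceFreeNorm a / coneRadius n β)) := by
  set c := coneRadius n β with hc
  have hc0 : 0 < c := coneRadius_pos h0 h1
  have hc2 : c ^ 2 * (β / 2) ^ 2 = 1 / n - β := sq_coneRadius_mul h0 h1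
  have hn' : (n : ℝ) ≠ 0 := Nat.cast_ne_zero.2 hn
  set u := traceFreeDir a with hu
  set γ := traceFreeNorm a / c with hγc
  have hγ0 : 0 ≤ γ := div_nonneg (Real.sqrt_nonneg _) hc0.le
  set σ := ∑ i, a i with hσ
  set ρ := Real.exp (β / 2 * σ) with hρ
  -- the segment from `1` to `ρ * exp (γ * I)`
  set z' : ℂ := Complex.exp ((β / 2 * σ : ℝ) + γ * Complex.I) - 1 with hz'
  let z : ℝ → ℂ := fun t => 1 + t * z'
  have hre : (Complex.exp ((β / 2 * σ : ℝ) + γ * Complex.I)).re = ρ * Real.cos γ := by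
    rw [Complex.exp_re]; simp [hρ]
  have him : (Complex.exp ((β / 2 * σ : ℝ) + γ * Complex.I)).im = ρ * Real.sin γ := by
    rw [Complex.exp_im]; simp [hρ]
  have hz'n : ‖z'‖ = Real.sqrt (sqChord ρ γ) := by
    rw [sqChord_eq, Complex.norm_eq_sqrt_sq_add_sq, hz']
    simp only [Complex.sub_re, Complex.sub_im, hre, him, Complex.one_re, Complex.one_im, sub_zero]
  have hcos : 0 < Real.cos γ := Real.cos_pos_of_mem_Ioo ⟨by linarith [Real.pi_pos], hγ⟩
  have hzs : ∀ t ∈ Set.Icc (0 : ℝ) 1, z t ∈ Complex.slitPlane := by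
    intro t ht
    left
    have h2 : (z t).re = (1 - t) + t * (ρ * Real.cos γ) := by
      simp only [z, hz', Complex.add_re, Complex.re_ofReal_mul, Complex.sub_re, hre,
        Complex.one_re]
      ring
    have h3 : 0 < ρ * Real.cos γ := mul_pos (Real.exp_pos _) hcos
    rw [h2]
    rcases ht.2.lt_or_eq with h | h
    · have := mul_nonneg ht.1 h3.le; linarith
    · rw [h]; linarith
  have hzd : ∀ t, HasDerivAt z z' t := fun t => by
    simpa [z] using (((Complex.ofRealCLM.hasDerivAt (x := t)).mul_const z').const_add 1)
  have hzc : ContDiff ℝ 2 z :=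
    contDiff_const.add (Complex.ofRealCLM.contDiff.mul contDiff_const)
  have hld : ∀ t ∈ Set.Icc (0 : ℝ) 1, HasDerivAt (fun t => Complex.log (z t)) (z' / z t) t :=
    fun t ht => (hzd t).clog_real (hzs t ht)
  have hlc : ContDiffOn ℝ 2 (fun t => Complex.log (z t)) (Set.Icc 0 1) := by
    intro t ht
    exact ((Complex.contDiffAt_log (hzs t ht)).restrict_scalars ℝ).comp_contDiffWithinAt t
      hzc.contDiffWithinAt
  -- the logarithms of the entries: the sum of the `y t i` is `2 / β` times the logarithm of the
  -- radius, and the component along `u` is `c` times the angle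
  let y : ℝ → Fin n → ℝ := fun t i =>
    2 / (n * β) * (Complex.log (z t)).re + c * u i * (Complex.log (z t)).im
  have hy0 : ∀ i, y 0 i = 0 := by simp [y, z]
  have hl1 : Complex.log (z 1) = (β / 2 * σ : ℝ) + γ * Complex.I := by
    have : z 1 = Complex.exp ((β / 2 * σ : ℝ) + γ * Complex.I) := by simp [z, hz']
    rw [this, Complex.log_exp]
    · simp; linarith [Real.pi_pos]
    · simp; linarith [Real.pi_pos]
  have hy1 : ∀ i, y 1 i = a i := by
    intro i
    have h2 : c * γ = traceFreeNorm a := by rw [hγc]; field_simp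
    have h3 := traceFreeNorm_mul_traceFreeDir a i
    simp only [y, hl1]
    simp only [Complex.add_re, Complex.add_im, Complex.ofReal_re, Complex.ofReal_im,
      Complex.re_ofReal_mul, Complex.im_ofReal_mul, Complex.I_re, Complex.I_im]
    have h4 : 2 / (n * β) * (β / 2 * σ + γ * 0) = σ / n := by field_simp; ring
    rw [h4]
    linear_combination u i * h2 + h3
  refine ⟨_, ?_, length_diagonal_le (y := y) (v := fun t i =>
    2 / (n * β) * (z' / z t).re + c * u i * (z' / z t).im) ?_ ?_⟩
  · have := isCurve_diagonal (y := y) fun i =>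
      (contDiffOn_const.mul (Complex.reCLM.contDiff.comp_contDiffOn hlc)).add
        (contDiffOn_const.mul (Complex.imCLM.contDiff.comp_contDiffOn hlc))
    simpa [hy0, hy1] using this
  · intro t ht i
    exact (((Complex.reCLM.hasFDerivAt.comp_hasDerivAt t (hld t ht)).const_mul _).add
      ((Complex.imCLM.hasFDerivAt.comp_hasDerivAt t (hld t ht)).const_mul _)).hasDerivWithinAt
  · intro t ht
    have hz0 : z t ≠ 0 := Complex.slitPlane_ne_zero (hzs t ht)
    have hsum : ∀ p q : ℝ, ∑ i, (2 / (n * β) * p + c * u i * q) = 2 / β * p := by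
      intro p q
      rw [Finset.sum_add_distrib, ← Finset.sum_mul Finset.univ (fun i => c * u i) q,
        ← Finset.mul_sum Finset.univ u c, sum_traceFreeDir hn a]
      simp
      field_simp
    have hsumsq : ∀ p q : ℝ, ∑ i, (2 / (n * β) * p + c * u i * q) ^ 2 ≤
        (2 / β * p) ^ 2 / n + c ^ 2 * q ^ 2 := by
      intro p q
      have h2 : ∀ i, (2 / (n * β) * p + c * u i * q) ^ 2 = (2 / (n * β) * p) ^ 2 +
          2 * (2 / (n * β) * p) * c * q * u i + c ^ 2 * q ^ 2 * u i ^ 2 := fun i => by ring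
      simp only [h2, Finset.sum_add_distrib, ← Finset.mul_sum]
      rw [sum_traceFreeDir hn a]
      have h3 := mul_le_of_le_one_right (show 0 ≤ c ^ 2 * q ^ 2 by positivity)
        (sum_sq_traceFreeDir_le a)
      have h4 : ∑ i : Fin n, (2 / (n * β) * p) ^ 2 = (2 / β * p) ^ 2 / n := by
        simp
        field_simp
      rw [h4]
      linarith
    have hE : Real.exp (∑ i, y t i) ^ β = ‖z t‖ ^ 2 := by
      simp only [y]
      rw [hsum, ← Real.exp_mul, Complex.log_re]
      have : 2 / β * Real.log ‖z t‖ * β = (2 : ℕ) * Real.log ‖z t‖ := by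
        push_cast; field_simp
      rw [this, Real.exp_nat_mul, Real.exp_log (norm_pos_iff.2 hz0)]
    rw [hE, hsum]
    set d := z' / z t with hd
    have hzd : ‖z t‖ ^ 2 * (d.re ^ 2 + d.im ^ 2) = ‖z'‖ ^ 2 := by
      have h2 : d.re ^ 2 + d.im ^ 2 = ‖d‖ ^ 2 := by
        rw [Complex.sq_norm, Complex.normSq_apply]; ring
      rw [h2, hd, norm_div, div_pow]
      have := norm_pos_iff.2 hz0
      field_simp
    rw [← hz'n]
    apply Real.sqrt_le_iff.2 ⟨by positivity, ?_⟩
    have h2 := hsumsq d.re d.im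
    calc _ ≤ ‖z t‖ ^ 2 * ((2 / β * d.re) ^ 2 / n + c ^ 2 * d.im ^ 2 -
          β * (2 / β * d.re) * (2 / β * d.re)) := by gcongr
      _ = ‖z t‖ ^ 2 * ((1 / n - β) * (2 / β * d.re) ^ 2 + c ^ 2 * d.im ^ 2) := by ring
      _ = c ^ 2 * (‖z t‖ ^ 2 * (d.re ^ 2 + d.im ^ 2)) := by rw [← hc2]; field_simp
      _ = _ := by rw [hzd]; ring

theorem riemannianDist_one_diagonal (hn : n ≠ 0) {β : ℝ} (h0 : β ≠ 0) (h1 : β < 1 / (n : ℝ))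
    {a : Fin n → ℝ} (hγ : traceFreeNorm a / coneRadius n β < Real.pi / 2) :
    riemannianDist β 1 (diagonal fun i => Real.exp (a i)) =
      coneRadius n β * Real.sqrt
        (sqChord (Real.exp (β / 2 * ∑ i, a i)) (traceFreeNorm a / coneRadius n β)) := by
  obtain ⟨P, hP, hPl⟩ := exists_isCurve_length_le hn h0 h1 hγ
  exact le_antisymm ((riemannianDist_le β hP).trans hPl)
    (le_riemannianDist fun P hP => mul_sqrt_sqChord_le_length hn h0 h1 hP)

/-! ### Simultaneous diagonalization by congruence -/

theorem exists_orthogonal_conj_diagonal {X : Matrix (Fin n) (Fin n) ℝ} (hX : X.PosDef) :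
    ∃ (U : Matrix (Fin n) (Fin n) ℝ) (d : Fin n → ℝ), U * Uᵀ = 1 ∧ (∀ i, 0 < d i) ∧
      X = U * diagonal d * Uᵀ := by
  refine ⟨hX.isHermitian.eigenvectorUnitary, hX.isHermitian.eigenvalues, ?_,
    hX.eigenvalues_pos, ?_⟩
  · exact Unitary.mul_star_self_of_mem hX.isHermitian.eigenvectorUnitary.2
  · have := hX.isHermitian.spectral_theorem
    rw [Unitary.conjStarAlgAut_apply] at this
    exact this

/-- Two positive-definite matrices are simultaneously congruent to the identity and to a positive
diagonal matrix. -/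
theorem exists_congr_one_diagonal {A B : Matrix (Fin n) (Fin n) ℝ} (hA : A.PosDef)
    (hB : B.PosDef) : ∃ (G : Matrix (Fin n) (Fin n) ℝ) (a : Fin n → ℝ), IsUnit G.det ∧
      A = G * 1 * Gᵀ ∧ B = G * diagonal (fun i => Real.exp (a i)) * Gᵀ := by
  obtain ⟨U, d, hU, hd, hAU⟩ := exists_orthogonal_conj_diagonal hA
  set H := U * diagonal fun i => Real.sqrt (d i) with hH
  have hAH : A = H * Hᵀ := by
    have : diagonal d =
        diagonal (fun i => Real.sqrt (d i)) * diagonal fun i => Real.sqrt (d i) := by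
      simp [fun i => Real.mul_self_sqrt (hd i).le]
    rw [hAU, hH, transpose_mul, diagonal_transpose, this]
    simp only [Matrix.mul_assoc]
  have hHu : IsUnit H.det := by
    rw [isUnit_iff_ne_zero]
    intro h
    have := hA.det_pos
    rw [hAH, det_mul, h, zero_mul] at this
    exact this.false
  have hHt : IsUnit Hᵀ.det := by rwa [det_transpose]
  have hC : (H⁻¹ * B * H⁻¹ᵀ).PosDef :=
    (Matrix.IsUnit.posDef_star_right_conjugate_iff
      ((isUnit_iff_isUnit_det _).2 (isUnit_nonsing_inv_det_iff.2 hHu))).2 hB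
  obtain ⟨V, e, hV, he, hCV⟩ := exists_orthogonal_conj_diagonal hC
  have hVu : IsUnit V.det := isUnit_det_of_right_inverse hV
  refine ⟨H * V, fun i => Real.log (e i), ?_, ?_, ?_⟩
  · rw [det_mul]; exact hHu.mul hVu
  · rw [Matrix.mul_one, transpose_mul, Matrix.mul_assoc H, ← Matrix.mul_assoc V, hV,
      Matrix.one_mul, hAH]
  · have h1 : (diagonal fun i => Real.exp (Real.log (e i))) = diagonal e := by
      congr 1; ext i; exact Real.exp_log (he i)
    have h2 : B = H * (H⁻¹ * B * H⁻¹ᵀ) * Hᵀ := by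
      rw [transpose_nonsing_inv]
      simp only [Matrix.mul_assoc]
      rw [nonsing_inv_mul _ hHt, Matrix.mul_one, mul_nonsing_inv_cancel_left _ _ hHu]
    rw [h1, transpose_mul]
    conv_lhs => rw [h2, hCV]
    simp only [Matrix.mul_assoc]

theorem det_mul_mul_transpose {G : Matrix (Fin n) (Fin n) ℝ} (X : Matrix (Fin n) (Fin n) ℝ) :
    (G * X * Gᵀ).det = |G.det| ^ 2 * X.det := by
  rw [sq_abs, det_mul, det_mul, det_transpose]; ring

/-- The matrix whose eigenvalues define `affineDist` is similar to `q / p` times the diagonal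
matrix. -/
theorem affineDist_smul_congr {G : Matrix (Fin n) (Fin n) ℝ} (hG : IsUnit G.det) {p q : ℝ}
    (hp : 0 < p) (hq : 0 < q) (a : Fin n → ℝ) :
    affineDist (p • (G * 1 * Gᵀ)) (q • (G * diagonal (fun i => Real.exp (a i)) * Gᵀ)) =
      Real.sqrt (∑ i, (a i + (Real.log q - Real.log p)) ^ 2) := by
  have hG' : IsUnit Gᵀ.det := by rwa [det_transpose]
  have hdet : IsUnit (G * 1 * Gᵀ).det := by
    rw [det_mul, Matrix.mul_one]; exact hG.mul hG'
  have h1 : (p • (G * 1 * Gᵀ))⁻¹ * (q • (G * diagonal (fun i => Real.exp (a i)) * Gᵀ)) =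
      Gᵀ⁻¹ * diagonal (fun i => Real.exp (a i + (Real.log q - Real.log p))) * Gᵀ := by
    have h2 : (diagonal fun i => Real.exp (a i + (Real.log q - Real.log p))) =
        (q / p) • diagonal fun i => Real.exp (a i) := by
      rw [← diagonal_smul]
      congr 1; ext i
      rw [Real.exp_add, Real.exp_sub, Real.exp_log hq, Real.exp_log hp, Pi.smul_apply, smul_eq_mul,
        mul_comm]
    have := Matrix.inv_smul' (G * 1 * Gᵀ) (Units.mk0 p hp.ne') hdet
    rw [Units.smul_def, Units.smul_def, Units.val_inv_eq_inv_val, Units.val_mk0] at this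
    rw [this, smul_mul_smul_comm, inv_mul_congr hG, h2, inv_one, Matrix.one_mul,
      Matrix.mul_smul, Matrix.smul_mul, inv_mul_eq_div]
  have h3 := charpoly_units_conj' (nonsingInvUnit Gᵀ hG')
    (diagonal fun i => Real.exp (a i + (Real.log q - Real.log p)))
  change (Gᵀ⁻¹ * _ * Gᵀ).charpoly = _ at h3
  rw [affineDist, h1, h3, charpoly_diagonal]
  have h4 : (∏ i, (Polynomial.X - Polynomial.C
      (Real.exp (a i + (Real.log q - Real.log p))))).roots =
      Finset.univ.val.map fun i => Real.exp (a i + (Real.log q - Real.log p)) := by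
    rw [← Polynomial.roots_multiset_prod_X_sub_C (Finset.univ.val.map _), Multiset.map_map]
    rfl
  rw [h4, Multiset.map_map]
  simp [Finset.sum]

theorem affineDist_congr {G : Matrix (Fin n) (Fin n) ℝ} (hG : IsUnit G.det) (a : Fin n → ℝ) :
    affineDist (G * 1 * Gᵀ) (G * diagonal (fun i => Real.exp (a i)) * Gᵀ) =
      Real.sqrt (∑ i, a i ^ 2) := by
  simpa using affineDist_smul_congr hG one_pos one_pos a

theorem affineDist_normalize_congr {G : Matrix (Fin n) (Fin n) ℝ} (hG : IsUnit G.det)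
    (a : Fin n → ℝ) :
    affineDist (normalize (G * 1 * Gᵀ))
      (normalize (G * diagonal (fun i => Real.exp (a i)) * Gᵀ)) = traceFreeNorm a := by
  have hg : 0 < |G.det| := abs_pos.2 hG.ne_zero
  have h1 : 0 < (G * 1 * Gᵀ).det := by rw [det_mul_mul_transpose, det_one]; positivity
  have h2 : (G * diagonal (fun i => Real.exp (a i)) * Gᵀ).det =
      (G * 1 * Gᵀ).det * Real.exp (∑ i, a i) := by
    rw [det_mul_mul_transpose, det_mul_mul_transpose, det_one, det_diagonal, Real.exp_sum, mul_one]
  have h3 : 0 < (G * diagonal (fun i => Real.exp (a i)) * Gᵀ).det := by rw [h2]; positivity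
  rw [normalize, normalize, affineDist_smul_congr hG (Real.rpow_pos_of_pos h1 _)
    (Real.rpow_pos_of_pos h3 _), Real.log_rpow h1, Real.log_rpow h3, h2,
    Real.log_mul h1.ne' (Real.exp_pos _).ne', Real.log_exp, traceFreeNorm]
  congr 1
  refine Finset.sum_congr rfl fun i _ => ?_
  ring

theorem angle_congr (β : ℝ) {G : Matrix (Fin n) (Fin n) ℝ} (hG : IsUnit G.det) (a : Fin n → ℝ) :
    angle β (G * 1 * Gᵀ) (G * diagonal (fun i => Real.exp (a i)) * Gᵀ) =
      traceFreeNorm a / coneRadius n β := by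
  rw [angle, affineDist_normalize_congr hG, coneRadius, div_div_eq_mul_div, mul_comm]

/-- The quantity under the square root in the distance formula scales under congruence like the
square of the distance. -/
theorem sqrt_congr_eq (β γ : ℝ) {G : Matrix (Fin n) (Fin n) ℝ} (a : Fin n → ℝ) :
    Real.sqrt (((G * 1 * Gᵀ).det ^ (β / 2) -
        (G * diagonal (fun i => Real.exp (a i)) * Gᵀ).det ^ (β / 2)) ^ 2 +
      4 * ((G * 1 * Gᵀ).det * (G * diagonal (fun i => Real.exp (a i)) * Gᵀ).det) ^ (β / 2) *
        Real.sin (γ / 2) ^ 2) =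
      |G.det| ^ β * Real.sqrt (sqChord (Real.exp (β / 2 * ∑ i, a i)) γ) := by
  have h1 : ((G * 1 * Gᵀ).det) ^ (β / 2) = |G.det| ^ β := by
    rw [det_mul_mul_transpose, det_one, mul_one, ← Real.rpow_natCast,
      ← Real.rpow_mul (abs_nonneg _)]
    congr 1; push_cast; ring
  have h2 : (G * diagonal (fun i => Real.exp (a i)) * Gᵀ).det ^ (β / 2) =
      |G.det| ^ β * Real.exp (β / 2 * ∑ i, a i) := by
    rw [← h1, det_mul_mul_transpose, det_mul_mul_transpose, det_one, det_diagonal,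
      ← Real.exp_sum, mul_one, Real.mul_rpow (by positivity) (by positivity), ← Real.exp_mul,
      mul_comm (∑ i, a i)]
  rw [Real.mul_rpow (by rw [det_mul_mul_transpose, det_one]; positivity)
    (by rw [det_mul_mul_transpose, det_diagonal]; positivity), h1, h2]
  rw [← Real.sqrt_sq (Real.rpow_nonneg (abs_nonneg G.det) β), ← Real.sqrt_mul (sq_nonneg _),
    Real.sqrt_sq (Real.rpow_nonneg (abs_nonneg G.det) β), sqChord]
  congr 1
  ring

/-! ### The limit at zero -/

/-- A form of the distance whose only singularity at `β = 0` is a difference quotient of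
`exp`. -/
theorem coneRadius_mul_sqrt_sqChord {β : ℝ} (h0 : β ≠ 0) (h1 : β < 1 / (n : ℝ)) (s τ : ℝ) :
    coneRadius n β * Real.sqrt (sqChord (Real.exp (β / 2 * s)) (τ / coneRadius n β)) =
      Real.sqrt (4 * (1 / n - β) * (β⁻¹ * (Real.exp (β / 2 * s) - 1)) ^ 2 +
        Real.exp (β / 2 * s) *
          (τ * Real.sinc (|β| * τ / (2 * Real.sqrt (1 / n - β)) / 2)) ^ 2) := by
  have hc := coneRadius_pos h0 h1
  have hc2 := sq_coneRadius_mul h0 h1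
  set c := coneRadius n β with hcd
  have hγ : |β| * τ / (2 * Real.sqrt (1 / n - β)) = τ / c := by
    rw [hcd, coneRadius, div_div_eq_mul_div, mul_comm]
  have hsinc : τ * Real.sinc (τ / c / 2) = 2 * c * Real.sin (τ / c / 2) := by
    by_cases h : τ = 0
    · simp [h]
    · rw [Real.sinc_of_ne_zero (by positivity)]
      field_simp
  rw [hγ, hsinc, ← hc2, sqChord]
  conv_lhs => rw [← Real.sqrt_sq hc.le, ← Real.sqrt_mul (sq_nonneg _), Real.sqrt_sq hc.le]
  congr 1
  field_simp
  ring

theorem tendsto_coneRadius_mul_sqrt_sqChord (hn : n ≠ 0) (s τ : ℝ) :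
    Tendsto (fun β : ℝ => coneRadius n β *
      Real.sqrt (sqChord (Real.exp (β / 2 * s)) (τ / coneRadius n β))) (𝓝[≠] 0)
      (𝓝 (Real.sqrt (s ^ 2 / n + τ ^ 2))) := by
  have hn' : 0 < 1 / (n : ℝ) := by have := Nat.pos_of_ne_zero hn; positivity
  have hlt : ∀ᶠ β : ℝ in 𝓝[≠] 0, β < 1 / (n : ℝ) :=
    mem_nhdsWithin_of_mem_nhds (Iio_mem_nhds hn')
  have hne : ∀ᶠ β : ℝ in 𝓝[≠] 0, β ≠ 0 := self_mem_nhdsWithin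
  have heq : (fun β : ℝ => Real.sqrt (4 * (1 / n - β) * (β⁻¹ * (Real.exp (β / 2 * s) - 1)) ^ 2 +
        Real.exp (β / 2 * s) *
          (τ * Real.sinc (|β| * τ / (2 * Real.sqrt (1 / n - β)) / 2)) ^ 2)) =ᶠ[𝓝[≠] 0]
      fun β : ℝ => coneRadius n β *
        Real.sqrt (sqChord (Real.exp (β / 2 * s)) (τ / coneRadius n β)) := by
    filter_upwards [hlt, hne] with β h1 h0 using (coneRadius_mul_sqrt_sqChord h0 h1 s τ).symm
  refine Tendsto.congr' heq ?_
  have hid : Tendsto (fun β : ℝ => β) (𝓝[≠] 0) (𝓝 0) :=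
    tendsto_nhdsWithin_of_tendsto_nhds tendsto_id
  have hslope : Tendsto (fun β : ℝ => β⁻¹ * (Real.exp (β / 2 * s) - 1)) (𝓝[≠] 0) (𝓝 (s / 2)) := by
    have h : HasDerivAt (fun β : ℝ => Real.exp (β / 2 * s)) (s / 2) 0 := by
      have := (((hasDerivAt_id (0 : ℝ)).div_const 2).mul_const s).exp
      simp only [id, zero_div, zero_mul, Real.exp_zero, one_mul] at this
      convert this using 1
      ring
    simpa using hasDerivAt_iff_tendsto_slope_zero.1 h
  have hexp : Tendsto (fun β : ℝ => Real.exp (β / 2 * s)) (𝓝[≠] 0) (𝓝 1) := by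
    have : ContinuousAt (fun β : ℝ => Real.exp (β / 2 * s)) 0 := by fun_prop
    simpa [Function.comp_def] using this.tendsto.comp hid
  have hsinc : Tendsto (fun β : ℝ => Real.sinc (|β| * τ / (2 * Real.sqrt (1 / n - β)) / 2))
      (𝓝[≠] 0) (𝓝 1) := by
    have h2 : (2 * Real.sqrt (1 / (n : ℝ) - 0)) ≠ 0 := by
      rw [sub_zero]; exact (mul_pos two_pos (Real.sqrt_pos.2 hn')).ne'
    have : ContinuousAt (fun β : ℝ => |β| * τ / (2 * Real.sqrt (1 / n - β)) / 2) 0 :=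
      (ContinuousAt.div (f := fun β : ℝ => |β| * τ)
        (g := fun β : ℝ => 2 * Real.sqrt (1 / n - β)) (by fun_prop) (by fun_prop) h2).div_const 2
    have := (Real.continuous_sinc.continuousAt.comp this).tendsto.comp hid
    simpa [Function.comp_def] using this
  have := ((((hid.const_sub (1 / (n : ℝ))).const_mul 4).mul (hslope.pow 2)).add
    (hexp.mul ((hsinc.const_mul τ).pow 2))).sqrt
  convert this using 2
  congr 1
  ring

theorem eventually_angle_lt (hn : n ≠ 0) (τ : ℝ) :
    ∀ᶠ β : ℝ in 𝓝[≠] 0, τ / coneRadius n β < Real.pi / 2 := by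
  have hn' : 0 < 1 / (n : ℝ) := by have := Nat.pos_of_ne_zero hn; positivity
  have h2 : (2 * Real.sqrt (1 / (n : ℝ) - 0)) ≠ 0 := by
    rw [sub_zero]; exact (mul_pos two_pos (Real.sqrt_pos.2 hn')).ne'
  have h : ContinuousAt (fun β : ℝ => τ * |β| / (2 * Real.sqrt (1 / n - β))) 0 :=
    ContinuousAt.div (f := fun β : ℝ => τ * |β|)
      (g := fun β : ℝ => 2 * Real.sqrt (1 / n - β)) (by fun_prop) (by fun_prop) h2
  have := h.tendsto.eventually_lt_const (u := Real.pi / 2)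
    (by rw [abs_zero, mul_zero, zero_div]; exact Real.pi_div_two_pos)
  filter_upwards [mem_nhdsWithin_of_mem_nhds this] with β hβ
  rwa [coneRadius, div_div_eq_mul_div]

end

end PowerPotential

theorem mainTheorem4 (n : ℕ) (hn : 1 ≤ n) (A B : Matrix (Fin n) (Fin n) ℝ)
    (hA : A.PosDef) (hB : B.PosDef) :
    (∀ β : ℝ, β ≠ 0 → β < 1 / (n : ℝ) →
      0 < PowerPotential.angle β A B → PowerPotential.angle β A B < Real.pi / 2 →
      PowerPotential.riemannianDist β A B =
        2 * Real.sqrt (1 / (n : ℝ) - β) / |β| *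
          Real.sqrt ((A.det ^ (β / 2) - B.det ^ (β / 2)) ^ 2 +
            4 * (A.det * B.det) ^ (β / 2) *
              Real.sin (PowerPotential.angle β A B / 2) ^ 2)) ∧
    PowerPotential.riemannianDist 0 A B = PowerPotential.affineDist A B ∧
    Tendsto (fun β : ℝ => PowerPotential.riemannianDist β A B) (𝓝[≠] 0)
      (𝓝 (PowerPotential.affineDist A B)) := by
  have hn0 : n ≠ 0 := Nat.one_le_iff_ne_zero.1 hn
  obtain ⟨G, a, hG, rfl, rfl⟩ := PowerPotential.exists_congr_one_diagonal hA hB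
  refine ⟨fun β h0 h1 _ hγ => ?_, ?_, ?_⟩
  · rw [PowerPotential.angle_congr β hG] at hγ ⊢
    rw [PowerPotential.sqrt_congr_eq, PowerPotential.riemannianDist_congr β hG,
      PowerPotential.riemannianDist_one_diagonal hn0 h0 h1 hγ, PowerPotential.coneRadius]
    ring
  · rw [PowerPotential.riemannianDist_congr 0 hG, PowerPotential.riemannianDist_zero_one_diagonal,
      PowerPotential.affineDist_congr hG, Real.rpow_zero, one_mul]
  · rw [PowerPotential.affineDist_congr hG, PowerPotential.sum_sq_eq hn0]
    have hlt : ∀ᶠ β : ℝ in 𝓝[≠] 0, β < 1 / (n : ℝ) :=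
      mem_nhdsWithin_of_mem_nhds (Iio_mem_nhds (by
        have := Nat.pos_of_ne_zero hn0; positivity))
    have hne : ∀ᶠ β : ℝ in 𝓝[≠] 0, β ≠ 0 := self_mem_nhdsWithin
    have heq : (fun β : ℝ => |G.det| ^ β * (PowerPotential.coneRadius n β *
          Real.sqrt (PowerPotential.sqChord (Real.exp (β / 2 * ∑ i, a i))
            (PowerPotential.traceFreeNorm a / PowerPotential.coneRadius n β)))) =ᶠ[𝓝[≠] 0]
        fun β => PowerPotential.riemannianDist β (G * 1 * G.transpose)
          (G * Matrix.diagonal (fun i => Real.exp (a i)) * G.transpose) := by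
      filter_upwards [hlt, hne, PowerPotential.eventually_angle_lt hn0
        (PowerPotential.traceFreeNorm a)] with β h1 h0 hγ
      rw [PowerPotential.riemannianDist_congr β hG,
        PowerPotential.riemannianDist_one_diagonal hn0 h0 h1 hγ]
    refine Tendsto.congr' heq ?_
    have hpow : Tendsto (fun β : ℝ => |G.det| ^ β) (𝓝[≠] 0) (𝓝 1) := by
      have := (Real.continuousAt_const_rpow (a := |G.det|) (b := 0)
        (abs_ne_zero.2 hG.ne_zero)).tendsto
      rw [Real.rpow_zero] at this
      exact this.mono_left nhdsWithin_le_nhds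
    simpa using hpow.mul (PowerPotential.tendsto_coneRadius_mul_sqrt_sqChord hn0 (∑ i, a i)
      (PowerPotential.traceFreeNorm a))
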